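/- Let $\mathsf k$ be a field and let $r,q\ge 1$ be integers. Let $S=\mathsf k[x_A : \emptyset\ne A\subseteq\{1,\dots,q\}]$, let $\epsilon_i=\prod_{A\ni i}x_A$ for $1\le i\le q$, and let $\mathcal E_q=(\epsilon_1,\dots,\epsilon_q)\subseteq S$ be the $q$-extremal ideal. For $\mathbf c\in\mathbb N^q$ write $|\mathbf c|=c_1+\cdots+c_q$ and $\epsilon^{\mathbf c}=\epsilon_1^{c_1}\cdots\epsilon_q^{c_q}$. For an ideal $I$ of $S$ generated by monomials, let $\beta_{i,\mathbf m}(I)$ denote the number of basis elements of multidegree $\mathbf m$ in homological degree $i$ of a minimal multigraded free resolution $\cdots\to F_1\to F_0\to I\to 0$ of $I$ over $S$ (so $F_0$ is in homological degree $0$ and corresponds to the minimal generators of $I$). Let $\mathbf a\in\mathbb N^q$ with $r-q<|\mathbf a|<r$, put $$\epsilon^{\mathbf a}\,\mathcal U_q^{\,r-|\mathbf a|}=\{\epsilon^{\mathbf c} : \mathbf c\in\mathbb N^q,\ |\mathbf c|=r,\ a_i\le c_i\le a_i+1\text{ for all } i\},$$ a set of $\binom{q}{r-|\mathbf a|}$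 monomials, and let $\mathbf m$ be the least common multiple of its elements. Then $$\beta_{i,\mathbf m}\big({\mathcal E_q}^r\big)=1\qquad\text{where}\qquad i=\binom{q}{r-|\mathbf a|}-1 .$$ -/

import Mathlib

/-! Multigraded minimal free resolutions of ideals in a polynomial ring, extremal ideals,
and the monomial labels of the sets `ε^a U_q^{r-|a|}`. -/

open MvPolynomial

section Resolutions

variable {σ k : Type*} [Field k]

/-- In the free module `S^n = ⊕_b S e_b` over `S = k[x_s : s ∈ σ]`, where the basis vector `e_b` has
multidegree `deg b ∈ ℕ^σ`, the vector `v` is homogeneous of multidegree `m`: every monomial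
`x^s` occurring in the coefficient of `e_b` satisfies `s + deg b = m` (zero is homogeneous of
every multidegree). -/
def IsHomogeneousVector {n : ℕ} (deg : Fin n → σ →₀ ℕ) (m : σ →₀ ℕ)
    (v : Fin n → MvPolynomial σ k) : Prop :=
  ∀ b, ∀ s ∈ (v b).support, s + deg b = m

/-- A minimal multigraded free resolution
`⋯ → F 2 → F 1 → F 0 → I → 0` of an ideal `I` of `S = k[x_s : s ∈ σ]`, with free
modules of finite rank.  The module `F i` is `S^(rank i)`, and its `b`-th basis vector has
multidegree `deg i b`. The module `F 0` sits in homological degree `0` and maps onto `I`. -/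
structure MinimalMultigradedFreeResolution (I : Ideal (MvPolynomial σ k)) where
  /-- the rank of `F i` -/
  rank : ℕ → ℕ
  /-- the multidegrees of the basis vectors of `F i` -/
  deg : ∀ i, Fin (rank i) → σ →₀ ℕ
  /-- the differential `F (i + 1) → F i` -/
  d : ∀ i, (Fin (rank (i + 1)) → MvPolynomial σ k) →ₗ[MvPolynomial σ k]
    (Fin (rank i) → MvPolynomial σ k)
  /-- the augmentation `F 0 → I ⊆ S` -/
  aug : (Fin (rank 0) → MvPolynomial σ k) →ₗ[MvPolynomial σ k] MvPolynomial σ k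
  /-- the differentials preserve multidegrees -/
  d_homogeneous : ∀ i m v, IsHomogeneousVector (deg (i + 1)) m v →
    IsHomogeneousVector (deg i) m (d i v)
  /-- the augmentation preserves multidegrees -/
  aug_homogeneous : ∀ m v, IsHomogeneousVector (deg 0) m v → ∀ s ∈ (aug v).support, s = m
  /-- the image of the augmentation is `I` -/
  range_aug : LinearMap.range aug = I
  /-- exactness at `F 0` -/
  exact_zero : Function.Exact (d 0) aug
  /-- exactness at `F (i + 1)` -/
  exact_succ : ∀ i, Function.Exact (d (i + 1)) (d i)
  /-- minimality: the image of each differential lies in `(x_s : s ∈ σ) F i` -/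
  minimal : ∀ i, LinearMap.range (d i) ≤
    Ideal.span (Set.range (X : σ → MvPolynomial σ k)) •
      (⊤ : Submodule (MvPolynomial σ k) (Fin (rank i) → MvPolynomial σ k))

/-- The number of basis vectors of multidegree `m` in homological degree `i`, that is, the
exponent of `S(m)` in the decomposition of `F i`. -/
noncomputable def MinimalMultigradedFreeResolution.numGenerators
    {I : Ideal (MvPolynomial σ k)} (F : MinimalMultigradedFreeResolution I)
    (i : ℕ) (m : σ →₀ ℕ) : ℕ :=
  Nat.card {b : Fin (F.rank i) // F.deg i b = m}

/-- `β_{i,m}(I) = β`: the ideal `I` has a minimal multigraded free resolution, and every such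
resolution has exactly `β` basis vectors of multidegree `m` in homological degree `i`. -/
def HasMultigradedBetti (I : Ideal (MvPolynomial σ k)) (i : ℕ) (m : σ →₀ ℕ) (β : ℕ) : Prop :=
  Nonempty (MinimalMultigradedFreeResolution I) ∧
    ∀ F : MinimalMultigradedFreeResolution I, F.numGenerators i m = β

end Resolutions

section Extremal

/-- The index set of the variables `x_A`, `∅ ≠ A ⊆ [q]`. -/
abbrev ExtremalVar (q : ℕ) : Type := {A : Finset (Fin q) // A.Nonempty}

/-- The squarefree monomial `ε_i`, the product of all `x_A` with `i ∈ A`. -/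
noncomputable def extremalGen (k : Type*) [Field k] (q : ℕ) (i : Fin q) :
    MvPolynomial (ExtremalVar q) k :=
  ∏ A : ExtremalVar q with i ∈ A.1, X A

/-- The extremal ideal `E_q = (ε_1, …, ε_q)`. -/
noncomputable def extremalIdeal (k : Type*) [Field k] (q : ℕ) :
    Ideal (MvPolynomial (ExtremalVar q) k) :=
  Ideal.span (Set.range (extremalGen k q))

/-- The exponent vector of the monomial `ε^c = ε_1^{c_1} ⋯ ε_q^{c_q}`: the exponent of `x_A` is
`∑_{i ∈ A} c_i`. -/
noncomputable def extremalExponent {q : ℕ} (c : Fin q → ℕ) : ExtremalVar q →₀ ℕ :=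
  Finsupp.equivFunOnFinite.symm fun A => ∑ i ∈ A.1, c i

/-- The monomial `ε^c` has exponent vector `extremalExponent c`. -/
theorem prod_extremalGen_pow (k : Type*) [Field k] {q : ℕ} (c : Fin q → ℕ) :
    ∏ i, extremalGen k q i ^ c i = monomial (extremalExponent c) 1 := by
  have h1 : ∀ i, extremalGen k q i ^ c i =
      ∏ A : ExtremalVar q, if i ∈ A.1 then (X A : MvPolynomial (ExtremalVar q) k) ^ c i else 1 := by
    intro i
    rw [extremalGen, ← Finset.prod_pow, Finset.prod_filter]
  simp_rw [h1]
  rw [Finset.prod_comm, monomial_eq, Finsupp.prod_fintype _ _ (fun _ => pow_zero _), C_1, one_mul]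
  refine Finset.prod_congr rfl fun A _ => ?_
  rw [← Finset.prod_filter, Finset.prod_pow_eq_pow_sum]
  simp [extremalExponent]

/-- The set `ε^a U_q^{r-|a|}` of all `ε^c` with `|c| = r` and `a_i ≤ c_i ≤ a_i + 1` for all `i`;
the monomial `ε^c` is represented by `c`. -/
def shiftedSquarefreeFace {q : ℕ} (r : ℕ) (a : Fin q → ℕ) : Finset (Fin q → ℕ) :=
  {c ∈ Finset.Icc a (a + 1) | ∑ i, c i = r}

/-- The monomial label of a set of monomials `ε^c`, given as a multidegree: the exponent
vector of their least common multiple, i.e. the coordinatewise maximum of their exponent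
vectors. -/
noncomputable def monomialLabel {q : ℕ} (s : Finset (Fin q → ℕ)) : ExtremalVar q →₀ ℕ :=
  s.sup extremalExponent

end Extremal

/-! Taylor's complex on all monomials ε^c with |c| = r resolves the r-th power of the extremal
ideal. Its basis consists of the nonempty sets W of such monomials, placed in homological degree |W|
- 1 and multidegree lcm W. Exactly one W has lcm equal to m, namely the given face. Indeed, every
ε^c dividing m lies in the face (`mem_face_of_le_monomialLabel`): the variables x_A with A a
singleton bound each c_i from above, those with A the complement of a point bound it from below.
Moreover no monomial of the face can be dropped (`eq_face_of_monomialLabel_eq`): among them only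
ε^(a + 1_B) attains the largest exponent of x_B. So Taylor's complex has one basis element of degree
m, in homological degree binom(q, r - |a|) - 1.

Taylor's complex need not be minimal, but a unique basis element of degree m leaves no scalar entry
between two elements of degree m. Two resolutions with this property have equally many basis
elements of degree m in each homological degree (`StrandResolution.card_eq_card`): comparison maps
compose to the identity up to homotopy, and on the degree-m blocks the homotopy terms vanish.

Setting all variables to 1 turns graded resolutions into complexes of matrices over k filtered by
degree, so the comparison is linear algebra. Taylor's complex is built only in this form, its
exactness coming from cones. A minimal resolution exists because minimal covers of syzygies can be
iterated over a Noetherian ring. -/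

/-- A matrix over `k` whose entry at `(c, b)` vanishes unless `deg c ≤ deg b`. -/
def IsFiltered {P k ι κ : Type*} [LE P] [Zero k] (degκ : κ → P) (degι : ι → P)
    (A : Matrix κ ι k) : Prop :=
  ∀ c b, A c b ≠ 0 → degκ c ≤ degι b

/-- A vector over `k` supported on the basis elements of degree at most `m`. -/
def IsBelow {P k ι : Type*} [LE P] [Zero k] (deg : ι → P) (m : P) (v : ι → k) : Prop :=
  ∀ b, v b ≠ 0 → deg b ≤ m

/-- The dehomogenization of a graded free resolution of a monomial ideal: a complex of matrices over
`k`, filtered by degree, such that every step of the filtration is exact. The predicate `Q` says in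
which degrees the ideal is nonzero. -/
structure StrandResolution (k : Type*) [Field k] {P : Type*} [PartialOrder P] (Q : P → Prop) where
  /-- the basis in homological degree `i` -/
  ι : ℕ → Type
  /-- the bases are finite -/
  fin : ∀ i, Fintype (ι i)
  /-- the degrees of the basis elements -/
  deg : ∀ i, ι i → P
  /-- the differentials -/
  D : ∀ i, Matrix (ι i) (ι (i + 1)) k
  /-- the augmentation -/
  aug : Matrix Unit (ι 0) k
  D_filtered : ∀ i, IsFiltered (deg i) (deg (i + 1)) (D i)
  aug_filtered : ∀ b, aug () b ≠ 0 → Q (deg 0 b)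
  aug_surjective : ∀ m, Q m → ∃ v, IsBelow (deg 0) m v ∧ aug.mulVec v = 1
  aug_mul_D : aug * D 0 = 0
  D_mul_D : ∀ i, D i * D (i + 1) = 0
  exact_zero : ∀ m v, IsBelow (deg 0) m v → aug.mulVec v = 0 →
    ∃ w, IsBelow (deg 1) m w ∧ (D 0).mulVec w = v
  exact_succ : ∀ i m v, IsBelow (deg (i + 1)) m v → (D i).mulVec v = 0 →
    ∃ w, IsBelow (deg (i + 2)) m w ∧ (D (i + 1)).mulVec w = v

attribute [instance] StrandResolution.fin

/-! ### Matrices filtered by degree. -/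

section Filtered

variable {P k ι κ μ : Type*} [PartialOrder P] [Field k] {degι : ι → P} {degκ : κ → P} {degμ : μ → P}

theorem IsFiltered.mul [Fintype κ] {A : Matrix μ κ k} {B : Matrix κ ι k}
    (hA : IsFiltered degμ degκ A) (hB : IsFiltered degκ degι B) :
    IsFiltered degμ degι (A * B) := by
  intro c b h
  rw [Matrix.mul_apply] at h
  obtain ⟨x, -, hx⟩ := Finset.exists_ne_zero_of_sum_ne_zero h
  exact (hA c x (left_ne_zero_of_mul hx)).trans (hB x b (right_ne_zero_of_mul hx))

theorem IsFiltered.sub {A B : Matrix κ ι k}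
    (hA : IsFiltered degκ degι A) (hB : IsFiltered degκ degι B) :
    IsFiltered degκ degι (A - B) := by
  intro c b h
  by_cases hc : A c b = 0
  · exact hB c b fun h' => h (by simp [hc, h'])
  · exact hA c b hc

theorem isFiltered_one [DecidableEq ι] : IsFiltered degι degι (1 : Matrix ι ι k) := by
  intro c b h
  by_cases hc : c = b
  · rw [hc]
  · simp [hc] at h

theorem IsFiltered.isBelow_col {A : Matrix κ ι k} (hA : IsFiltered degκ degι A) (b : ι) :
    IsBelow degκ (degι b) (fun c => A c b) :=
  fun c hc => hA c b hc

/-- Columnwise preimages along `p` assemble to a filtered lift. -/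
theorem exists_filtered_lift {ω : Type*} [Fintype κ] (p : Matrix ω κ k) (f : Matrix ω ι k)
    (h : ∀ b, ∃ w, IsBelow degκ (degι b) w ∧ p.mulVec w = fun x => f x b) :
    ∃ g : Matrix κ ι k, IsFiltered degκ degι g ∧ p * g = f := by
  choose w hw hp using h
  refine ⟨Matrix.of fun c b => w b c, fun c b hc => hw b c hc, ?_⟩
  ext x b
  exact congrFun (hp b) x

/-- On the block of basis elements of degree `m`, a product of filtered matrices only
involves basis elements of degree `m`. -/
theorem IsFiltered.mul_apply_eq_sum [Fintype κ] [DecidableEq P] {A : Matrix μ κ k}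
    {B : Matrix κ ι k} (hA : IsFiltered degμ degκ A) (hB : IsFiltered degκ degι B)
    {m : P} {c : μ} {b : ι} (hc : degμ c = m) (hb : degι b = m) :
    (A * B) c b = ∑ x : {x : κ // degκ x = m}, A c x * B x b := by
  rw [Matrix.mul_apply, ← Finset.sum_subtype ({x | degκ x = m} : Finset κ) (by simp)
    (fun x => A c x * B x b)]
  symm
  refine Finset.sum_subset (Finset.subset_univ _) fun x _ hx => ?_
  by_contra h
  refine hx (Finset.mem_filter.2 ⟨Finset.mem_univ x, le_antisymm ?_ ?_⟩)
  · exact (hB x b (right_ne_zero_of_mul h)).trans_eq hb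
  · exact hc.symm.trans_le (hA c x (left_ne_zero_of_mul h))

end Filtered

/-! ### Comparison of filtered resolutions. -/

namespace StrandResolution

variable {k : Type*} [Field k] {P : Type*} [PartialOrder P] {Q : P → Prop}

/-- The differentials have no nonzero scalar entries between basis elements of degree `m`. -/
def IsMinimalAt (F : StrandResolution k Q) (m : P) : Prop :=
  ∀ i b' b, F.deg i b' = m → F.deg (i + 1) b = m → F.D i b' b = 0

open Classical in
/-- The maps `φ : F → G` and `ψ : G → F` lifting the identity, with a homotopy from `ψ ∘ φ` to the
identity, in homological degree `i`. -/
theorem exists_comparison (F G : StrandResolution k Q) (m : P) (hF : F.IsMinimalAt m) (i : ℕ) :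
    ∃ (φ : Matrix (G.ι i) (F.ι i) k) (ψ : Matrix (F.ι i) (G.ι i) k) (R : Matrix (F.ι i) (F.ι i) k)
      (φ' : Matrix (G.ι (i + 1)) (F.ι (i + 1)) k) (ψ' : Matrix (F.ι (i + 1)) (G.ι (i + 1)) k)
      (h : Matrix (F.ι (i + 1)) (F.ι i) k),
      IsFiltered (G.deg i) (F.deg i) φ ∧ IsFiltered (F.deg i) (G.deg i) ψ ∧
      IsFiltered (G.deg (i + 1)) (F.deg (i + 1)) φ' ∧
      IsFiltered (F.deg (i + 1)) (G.deg (i + 1)) ψ' ∧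
      IsFiltered (F.deg (i + 1)) (F.deg i) h ∧
      G.D i * φ' = φ * F.D i ∧ F.D i * ψ' = ψ * G.D i ∧ F.D i * h = ψ * φ - 1 - R ∧
      R * F.D i = 0 ∧ ∀ b' b, F.deg i b' = m → F.deg i b = m → R b' b = 0 := by
  induction i with
  | zero =>
    have key : ∀ F G : StrandResolution k Q, ∃ φ : Matrix (G.ι 0) (F.ι 0) k,
        IsFiltered (G.deg 0) (F.deg 0) φ ∧ G.aug * φ = F.aug := by
      intro F G
      apply exists_filtered_lift
      intro b
      -- When the entry vanishes, `Q` is not known at the degree of `b`, so `b` is sent to 0.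
      by_cases hb : F.aug () b = 0
      · refine ⟨0, fun c hc => absurd rfl hc, ?_⟩
        ext; simp [hb]
      · obtain ⟨v, hv, hv'⟩ := G.aug_surjective _ (F.aug_filtered b hb)
        refine ⟨F.aug () b • v, fun c hc => hv c (right_ne_zero_of_mul hc), ?_⟩
        ext
        simp [Matrix.mulVec_smul, hv']
    have lift : ∀ (F : StrandResolution k Q) {ι : Type} (deg : ι → P) (f : Matrix (F.ι 0) ι k),
        IsFiltered (F.deg 0) deg f → F.aug * f = 0 →
        ∃ g : Matrix (F.ι 1) ι k, IsFiltered (F.deg 1) deg g ∧ F.D 0 * g = f := by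
      intro F ι deg f hf h0
      apply exists_filtered_lift
      intro b
      refine F.exact_zero _ _ (hf.isBelow_col b) ?_
      ext x
      exact congrFun (congrFun h0 x) b
    obtain ⟨φ, hφ, hφa⟩ := key F G
    obtain ⟨ψ, hψ, hψa⟩ := key G F
    obtain ⟨φ', hφ', hφe⟩ := lift G _ (φ * F.D 0) (hφ.mul (F.D_filtered 0))
      (by rw [← Matrix.mul_assoc, hφa, F.aug_mul_D])
    obtain ⟨ψ', hψ', hψe⟩ := lift F _ (ψ * G.D 0) (hψ.mul (G.D_filtered 0))
      (by rw [← Matrix.mul_assoc, hψa, G.aug_mul_D])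
    obtain ⟨h, hh, hhe⟩ := lift F _ (ψ * φ - 1) ((hψ.mul hφ).sub isFiltered_one)
      (by rw [Matrix.mul_sub, ← Matrix.mul_assoc, hψa, hφa, Matrix.mul_one, sub_self])
    -- `R` stands for the homotopy term coming from one degree lower, hence 0 here.
    exact ⟨φ, ψ, 0, φ', ψ', h, hφ, hψ, hφ', hψ', hh, hφe, hψe, by rw [hhe, sub_zero],
      Matrix.zero_mul _, fun _ _ _ _ => rfl⟩
  | succ i ih =>
    obtain ⟨φ, ψ, R, φ', ψ', h, -, -, hφ', hψ', hh, hφe, hψe, hhe, hR, -⟩ := ih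
    have lift : ∀ (F : StrandResolution k Q) {ι : Type} (deg : ι → P)
        (f : Matrix (F.ι (i + 1)) ι k), IsFiltered (F.deg (i + 1)) deg f → F.D i * f = 0 →
        ∃ g : Matrix (F.ι (i + 2)) ι k, IsFiltered (F.deg (i + 2)) deg g ∧ F.D (i + 1) * g = f := by
      intro F ι deg f hf h0
      apply exists_filtered_lift
      intro b
      refine F.exact_succ i _ _ (hf.isBelow_col b) ?_
      ext x
      exact congrFun (congrFun h0 x) b
    obtain ⟨φ₂, hφ₂, hφe₂⟩ := lift G _ (φ' * F.D (i + 1)) (hφ'.mul (F.D_filtered _))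
      (by rw [← Matrix.mul_assoc, hφe, Matrix.mul_assoc, F.D_mul_D, Matrix.mul_zero])
    obtain ⟨ψ₂, hψ₂, hψe₂⟩ := lift F _ (ψ' * G.D (i + 1)) (hψ'.mul (G.D_filtered _))
      (by rw [← Matrix.mul_assoc, hψe, Matrix.mul_assoc, G.D_mul_D, Matrix.mul_zero])
    -- The usual homotopy step: the error of ψ'φ' - 1 after subtracting h D is a cycle, since D h =
    -- ψφ - 1 - R and R D = 0.
    obtain ⟨h₂, hh₂, hhe₂⟩ := lift F _ (ψ' * φ' - 1 - h * F.D i)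
      (((hψ'.mul hφ').sub isFiltered_one).sub (hh.mul (F.D_filtered i))) (by
        rw [Matrix.mul_sub, Matrix.mul_sub, ← Matrix.mul_assoc, hψe, Matrix.mul_assoc, hφe,
          ← Matrix.mul_assoc (F.D i) h, hhe, Matrix.sub_mul, Matrix.sub_mul, hR,
          Matrix.mul_one, Matrix.one_mul, Matrix.mul_assoc, sub_zero, sub_self])
    refine ⟨φ', ψ', h * F.D i, φ₂, ψ₂, h₂, hφ', hψ', hφ₂, hψ₂, hh₂, hφe₂, hψe₂, hhe₂,
      by rw [Matrix.mul_assoc, F.D_mul_D, Matrix.mul_zero], fun b' b hb' hb => ?_⟩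
    -- The new `R` is h D; on the degree-m block it only passes through elements of degree m, where
    -- D vanishes.
    rw [hh.mul_apply_eq_sum (F.D_filtered i) hb' hb]
    exact Finset.sum_eq_zero fun x _ => by rw [hF i _ _ x.2 hb, mul_zero]

/-- A resolution that is minimal in degree `m` has the fewest basis elements of degree `m`. -/
theorem card_le_card (F G : StrandResolution k Q) (m : P) (hF : F.IsMinimalAt m) (i : ℕ) :
    Nat.card {b // F.deg i b = m} ≤ Nat.card {b // G.deg i b = m} := by
  classical
  obtain ⟨φ, ψ, R, -, -, h, hφ, hψ, -, -, hh, -, -, he, -, hR⟩ := exists_comparison F G m hF i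
  let A : Matrix {b // F.deg i b = m} {b // G.deg i b = m} k := ψ.submatrix (↑) (↑)
  let B : Matrix {b // G.deg i b = m} {b // F.deg i b = m} k := φ.submatrix (↑) (↑)
  -- Both homotopy terms, D h and `R`, vanish on the degree-m block, leaving a one-sided inverse;
  -- ranks then compare the sizes.
  have hAB : A * B = 1 := by
    ext b' b
    have h0 : (F.D i * h) b' b = 0 := by
      rw [(F.D_filtered i).mul_apply_eq_sum hh b'.2 b.2]
      exact Finset.sum_eq_zero fun x _ => by rw [hF i _ _ b'.2 x.2, zero_mul]
    rw [he, Matrix.sub_apply, Matrix.sub_apply, hR _ _ b'.2 b.2, sub_zero, sub_eq_zero,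
      hψ.mul_apply_eq_sum hφ b'.2 b.2] at h0
    rw [Matrix.mul_apply]
    refine h0.trans ?_
    simp [Matrix.one_apply, Subtype.ext_iff]
  rw [Nat.card_eq_fintype_card, Nat.card_eq_fintype_card]
  calc Fintype.card {b // F.deg i b = m}
      = (A * B).rank := by rw [hAB, Matrix.rank_one]
    _ ≤ A.rank := Matrix.rank_mul_le_left A B
    _ ≤ Fintype.card {b // G.deg i b = m} := A.rank_le_card_width

theorem card_eq_card (F G : StrandResolution k Q) (m : P) (hF : F.IsMinimalAt m)
    (hG : G.IsMinimalAt m) (i : ℕ) :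
    Nat.card {b // F.deg i b = m} = Nat.card {b // G.deg i b = m} :=
  le_antisymm (card_le_card F G m hF i) (card_le_card G F m hG i)

end StrandResolution

/-! ### Homogeneous vectors and dehomogenization. -/

section Homogeneous

variable {σ k : Type*} [Field k]

/-- The homogeneous component of multidegree `m` of a vector in a graded free module. -/
noncomputable def homogeneousPart {n : ℕ} (deg : Fin n → σ →₀ ℕ) (m : σ →₀ ℕ) :
    (Fin n → MvPolynomial σ k) →ₗ[k] (Fin n → MvPolynomial σ k) :=
  open Classical in
  LinearMap.pi fun b => if deg b ≤ m then
    (monomial (m - deg b)).comp ((lcoeff k (m - deg b)).comp (LinearMap.proj b)) else 0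

theorem homogeneousPart_apply {n : ℕ} (deg : Fin n → σ →₀ ℕ) (m : σ →₀ ℕ)
    (v : Fin n → MvPolynomial σ k) (b : Fin n) [Decidable (deg b ≤ m)] :
    homogeneousPart deg m v b =
      if deg b ≤ m then monomial (m - deg b) (coeff (m - deg b) (v b)) else 0 := by
  simp only [homogeneousPart, LinearMap.pi_apply]
  split_ifs <;> simp

theorem isHomogeneousVector_homogeneousPart {n : ℕ} (deg : Fin n → σ →₀ ℕ) (m : σ →₀ ℕ)
    (v : Fin n → MvPolynomial σ k) : IsHomogeneousVector deg m (homogeneousPart deg m v) := by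
  classical
  intro b s hs
  rw [homogeneousPart_apply] at hs
  split_ifs at hs with h
  · have := support_monomial_subset hs
    rw [Finset.mem_singleton] at this
    rw [this, tsub_add_cancel_of_le h]
  · simp at hs

theorem IsHomogeneousVector.eq_monomial {n : ℕ} {deg : Fin n → σ →₀ ℕ} {m : σ →₀ ℕ}
    {v : Fin n → MvPolynomial σ k} (hv : IsHomogeneousVector deg m v) (b : Fin n) :
    v b = monomial (m - deg b) (coeff (m - deg b) (v b)) := by
  classical
  ext s
  rw [coeff_monomial]
  split_ifs with h
  · rw [h]
  · by_contra hs
    exact h (by rw [← hv b s (mem_support_iff.2 hs), add_tsub_cancel_right])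

theorem IsHomogeneousVector.apply_eq_zero {n : ℕ} {deg : Fin n → σ →₀ ℕ} {m : σ →₀ ℕ}
    {v : Fin n → MvPolynomial σ k} (hv : IsHomogeneousVector deg m v) {b : Fin n}
    (hb : ¬ deg b ≤ m) : v b = 0 := by
  rw [← support_eq_empty, Finset.eq_empty_iff_forall_notMem]
  intro s hs
  exact hb (by rw [← hv b s hs]; exact le_add_self)

theorem IsHomogeneousVector.homogeneousPart_eq {n : ℕ} {deg : Fin n → σ →₀ ℕ} {m : σ →₀ ℕ}
    {v : Fin n → MvPolynomial σ k} (hv : IsHomogeneousVector deg m v) :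
    homogeneousPart deg m v = v := by
  classical
  ext1 b
  rw [homogeneousPart_apply]
  split_ifs with h
  · exact (hv.eq_monomial b).symm
  · exact (hv.apply_eq_zero h).symm

theorem IsHomogeneousVector.homogeneousPart_eq_zero {n : ℕ} {deg : Fin n → σ →₀ ℕ}
    {m m' : σ →₀ ℕ} {v : Fin n → MvPolynomial σ k} (hv : IsHomogeneousVector deg m v)
    (hm : m' ≠ m) : homogeneousPart deg m' v = 0 := by
  classical
  ext1 b
  rw [homogeneousPart_apply]
  split_ifs with h
  · suffices hs : coeff (m' - deg b) (v b) = 0 by rw [hs, monomial_zero, Pi.zero_apply]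
    by_contra hs
    exact hm (by rw [← hv b _ (mem_support_iff.2 hs), tsub_add_cancel_of_le h])
  · rw [Pi.zero_apply]

theorem isHomogeneousVector_single {n : ℕ} (deg : Fin n → σ →₀ ℕ) (b : Fin n) (s : σ →₀ ℕ)
    (c : k) : IsHomogeneousVector deg (s + deg b) (Pi.single b (monomial s c)) := by
  classical
  intro b' s' hs'
  by_cases h : b' = b
  · subst h
    rw [Pi.single_eq_same] at hs'
    rw [Finset.mem_singleton.1 (support_monomial_subset hs')]
  · rw [Pi.single_eq_of_ne h] at hs'
    simp at hs'

/-- A linear map of graded free modules that preserves multidegrees. -/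
def IsHomogeneousMap {n n' : ℕ} (deg : Fin n → σ →₀ ℕ) (deg' : Fin n' → σ →₀ ℕ)
    (d : (Fin n → MvPolynomial σ k) →ₗ[MvPolynomial σ k] (Fin n' → MvPolynomial σ k)) : Prop :=
  ∀ m v, IsHomogeneousVector deg m v → IsHomogeneousVector deg' m (d v)

/-- This makes kernels homogeneous submodules and lets any preimage of a homogeneous vector be
replaced by a homogeneous one. -/
theorem IsHomogeneousMap.map_homogeneousPart {n n' : ℕ} {deg : Fin n → σ →₀ ℕ}
    {deg' : Fin n' → σ →₀ ℕ}
    {d : (Fin n → MvPolynomial σ k) →ₗ[MvPolynomial σ k] (Fin n' → MvPolynomial σ k)}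
    (hd : IsHomogeneousMap deg deg' d) (m : σ →₀ ℕ) (v : Fin n → MvPolynomial σ k) :
    d (homogeneousPart deg m v) = homogeneousPart deg' m (d v) := by
  suffices h : (d.restrictScalars k).comp (homogeneousPart deg m) =
      (homogeneousPart deg' m).comp (d.restrictScalars k) from LinearMap.congr_fun h v
  -- By k-linearity it suffices to test x^s e_b, which has a single degree: taking the part of
  -- degree m either keeps it and its image or kills both.
  refine LinearMap.pi_ext' fun b => MvPolynomial.linearMap_ext fun s => LinearMap.ext_ring ?_
  have hv := isHomogeneousVector_single (k := k) deg b s 1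
  have hdv := hd _ _ hv
  change d (homogeneousPart deg m (Pi.single b (monomial s 1))) =
    homogeneousPart deg' m (d (Pi.single b (monomial s 1)))
  by_cases hm : m = s + deg b
  · rw [hm, hv.homogeneousPart_eq, hdv.homogeneousPart_eq]
  · rw [hv.homogeneousPart_eq_zero hm, hdv.homogeneousPart_eq_zero hm, map_zero]

/-- Setting all variables equal to `1` in a vector. -/
noncomputable def dehomogenize {n : ℕ} (v : Fin n → MvPolynomial σ k) : Fin n → k :=
  fun b => eval 1 (v b)

/-- The homogeneous vector of multidegree `m` with given dehomogenization. -/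
noncomputable def homogenize {n : ℕ} (deg : Fin n → σ →₀ ℕ) (m : σ →₀ ℕ) (v : Fin n → k) :
    Fin n → MvPolynomial σ k :=
  fun b => monomial (m - deg b) (v b)

theorem eval_one_monomial (s : σ →₀ ℕ) (c : k) : eval 1 (monomial s c) = c := by
  simp [eval_monomial, Finsupp.prod]

theorem dehomogenize_homogenize {n : ℕ} (deg : Fin n → σ →₀ ℕ) (m : σ →₀ ℕ) (v : Fin n → k) :
    dehomogenize (homogenize deg m v) = v := by
  ext1 b
  rw [dehomogenize, homogenize, eval_one_monomial]

theorem isHomogeneousVector_homogenize {n : ℕ} {deg : Fin n → σ →₀ ℕ} {m : σ →₀ ℕ}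
    {v : Fin n → k} (hv : IsBelow deg m v) :
    IsHomogeneousVector deg m (homogenize deg m v) := by
  classical
  intro b s hs
  have hb : v b ≠ 0 := fun h => by simp [homogenize, h] at hs
  rw [Finset.mem_singleton.1 (support_monomial_subset hs), tsub_add_cancel_of_le (hv b hb)]

theorem IsHomogeneousVector.homogenize_dehomogenize {n : ℕ} {deg : Fin n → σ →₀ ℕ} {m : σ →₀ ℕ}
    {v : Fin n → MvPolynomial σ k} (hv : IsHomogeneousVector deg m v) :
    homogenize deg m (dehomogenize v) = v := by
  ext1 b
  rw [homogenize, dehomogenize, hv.eq_monomial b, eval_one_monomial]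

theorem IsHomogeneousVector.isBelow {n : ℕ} {deg : Fin n → σ →₀ ℕ} {m : σ →₀ ℕ}
    {v : Fin n → MvPolynomial σ k} (hv : IsHomogeneousVector deg m v) :
    IsBelow deg m (dehomogenize v) := by
  intro b hb
  by_contra h
  exact hb (by rw [dehomogenize, hv.apply_eq_zero h, map_zero])

/-- The matrix over `k` of a map of free modules with all variables set equal to `1`. -/
noncomputable def dehomogenizeMap {n n' : ℕ}
    (d : (Fin n → MvPolynomial σ k) →ₗ[MvPolynomial σ k] (Fin n' → MvPolynomial σ k)) :
    Matrix (Fin n') (Fin n) k :=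
  Matrix.of fun b' b => eval 1 (d (Pi.single b 1) b')

theorem dehomogenizeMap_mulVec {n n' : ℕ}
    (d : (Fin n → MvPolynomial σ k) →ₗ[MvPolynomial σ k] (Fin n' → MvPolynomial σ k))
    (v : Fin n → MvPolynomial σ k) :
    (dehomogenizeMap d).mulVec (dehomogenize v) = dehomogenize (d v) := by
  ext b'
  conv_rhs => rw [← LinearMap.sum_single_apply (fun _ => MvPolynomial σ k) v]
  simp only [Matrix.mulVec, dotProduct, dehomogenizeMap, Matrix.of_apply, dehomogenize, map_sum,
    Finset.sum_apply]
  refine Finset.sum_congr rfl fun b _ => ?_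
  have : (Pi.single b (v b) : Fin n → MvPolynomial σ k) = v b • Pi.single b 1 := by
    rw [← Pi.single_smul, smul_eq_mul, mul_one]
  rw [this, map_smul, Pi.smul_apply, smul_eq_mul, map_mul, mul_comm]

theorem dehomogenizeMap_comp {n n' n'' : ℕ}
    (d : (Fin n → MvPolynomial σ k) →ₗ[MvPolynomial σ k] (Fin n' → MvPolynomial σ k))
    (d' : (Fin n' → MvPolynomial σ k) →ₗ[MvPolynomial σ k] (Fin n'' → MvPolynomial σ k)) :
    dehomogenizeMap (d'.comp d) = dehomogenizeMap d' * dehomogenizeMap d := by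
  ext b'' b
  exact (congrFun (dehomogenizeMap_mulVec d' (d (Pi.single b 1))) b'').symm

theorem isHomogeneousVector_basis {n : ℕ} (deg : Fin n → σ →₀ ℕ) (b : Fin n) :
    IsHomogeneousVector deg (deg b) (Pi.single b (1 : MvPolynomial σ k)) := by
  have := isHomogeneousVector_single (k := k) deg b 0 1
  rwa [zero_add] at this

theorem IsHomogeneousMap.isFiltered {n n' : ℕ} {deg : Fin n → σ →₀ ℕ} {deg' : Fin n' → σ →₀ ℕ}
    {d : (Fin n → MvPolynomial σ k) →ₗ[MvPolynomial σ k] (Fin n' → MvPolynomial σ k)}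
    (hd : IsHomogeneousMap deg deg' d) : IsFiltered deg' deg (dehomogenizeMap d) :=
  fun b' b h => (hd _ _ (isHomogeneousVector_basis deg b)).isBelow b' h

/-- A homogeneous vector of the image of a homogeneous map has a homogeneous preimage. -/
theorem IsHomogeneousMap.exists_preimage {n n' : ℕ} {deg : Fin n → σ →₀ ℕ}
    {deg' : Fin n' → σ →₀ ℕ}
    {d : (Fin n → MvPolynomial σ k) →ₗ[MvPolynomial σ k] (Fin n' → MvPolynomial σ k)}
    (hd : IsHomogeneousMap deg deg' d) {m : σ →₀ ℕ} {v : Fin n' → k} (hv : IsBelow deg' m v)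
    (h : homogenize deg' m v ∈ LinearMap.range d) :
    ∃ w, IsBelow deg m w ∧ (dehomogenizeMap d).mulVec w = v := by
  obtain ⟨u, hu⟩ := h
  refine ⟨dehomogenize (homogeneousPart deg m u),
    (isHomogeneousVector_homogeneousPart deg m u).isBelow, ?_⟩
  rw [dehomogenizeMap_mulVec, hd.map_homogeneousPart, hu,
    (isHomogeneousVector_homogenize hv).homogeneousPart_eq, dehomogenize_homogenize]

/-- A cycle over `k` below m homogenizes to a cycle over S of degree m, so exactness over S passes
to every step of the filtration. -/
theorem IsHomogeneousMap.exists_of_exact {n n' n'' : ℕ} {deg : Fin n → σ →₀ ℕ}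
    {deg' : Fin n' → σ →₀ ℕ} {deg'' : Fin n'' → σ →₀ ℕ}
    {d : (Fin n → MvPolynomial σ k) →ₗ[MvPolynomial σ k] (Fin n' → MvPolynomial σ k)}
    {d' : (Fin n' → MvPolynomial σ k) →ₗ[MvPolynomial σ k] (Fin n'' → MvPolynomial σ k)}
    (hd : IsHomogeneousMap deg deg' d) (hd' : IsHomogeneousMap deg' deg'' d')
    (hex : Function.Exact d d') {m : σ →₀ ℕ} {v : Fin n' → k} (hv : IsBelow deg' m v)
    (h : (dehomogenizeMap d').mulVec v = 0) :
    ∃ w, IsBelow deg m w ∧ (dehomogenizeMap d).mulVec w = v := by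
  refine hd.exists_preimage hv ((hex _).1 ?_)
  have hv' := isHomogeneousVector_homogenize hv
  rw [← (hd' _ _ hv').homogenize_dehomogenize, ← dehomogenizeMap_mulVec, dehomogenize_homogenize, h]
  ext1 b
  simp [homogenize]

theorem exact_mul_eq_zero {n n' n'' : ℕ}
    {d : (Fin n → MvPolynomial σ k) →ₗ[MvPolynomial σ k] (Fin n' → MvPolynomial σ k)}
    {d' : (Fin n' → MvPolynomial σ k) →ₗ[MvPolynomial σ k] (Fin n'' → MvPolynomial σ k)}
    (hex : Function.Exact d d') : dehomogenizeMap d' * dehomogenizeMap d = 0 := by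
  rw [← dehomogenizeMap_comp, hex.linearMap_comp_eq_zero]
  ext; simp [dehomogenizeMap]

/-- Turns minimality into the vanishing of constant terms of coordinates. -/
theorem span_range_X_eq_ker :
    Ideal.span (Set.range (X : σ → MvPolynomial σ k)) =
      RingHom.ker (constantCoeff : MvPolynomial σ k →+* k) := by
  ext p
  have hX : Set.range (X : σ → MvPolynomial σ k) = X '' Set.univ := by simp
  rw [hX, mem_ideal_span_X_image, RingHom.mem_ker, constantCoeff_eq]
  constructor
  · intro h
    by_contra h0
    obtain ⟨i, -, hi⟩ := h 0 (mem_support_iff.2 h0)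
    exact hi rfl
  · intro h s hs
    by_contra! hcon
    have : s = 0 := Finsupp.ext fun i => hcon i trivial
    exact mem_support_iff.1 hs (this ▸ h)

theorem mem_ideal_smul_top_pi {R : Type*} [CommRing R] {n : ℕ} (J : Ideal R) (v : Fin n → R) :
    v ∈ J • (⊤ : Submodule R (Fin n → R)) ↔ ∀ b, v b ∈ J := by
  constructor
  · intro h b
    have : J • (⊤ : Submodule R (Fin n → R)) ≤ Submodule.comap (LinearMap.proj b) J := by
      rw [Submodule.smul_le]
      intro r hr w _
      exact J.mul_mem_right _ hr
    exact this h
  · intro h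
    rw [← LinearMap.sum_single_apply (fun _ => R) v]
    refine Submodule.sum_mem _ fun b _ => ?_
    have : (Pi.single b (v b) : Fin n → R) = v b • Pi.single b 1 := by
      rw [← Pi.single_smul, smul_eq_mul, mul_one]
    rw [this]
    exact Submodule.smul_mem_smul (h b) trivial

theorem mem_span_X_smul_top {n : ℕ} (v : Fin n → MvPolynomial σ k) :
    v ∈ Ideal.span (Set.range (X : σ → MvPolynomial σ k)) •
      (⊤ : Submodule (MvPolynomial σ k) (Fin n → MvPolynomial σ k)) ↔ ∀ b, coeff 0 (v b) = 0 := by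
  rw [mem_ideal_smul_top_pi, span_range_X_eq_ker]
  rfl

/-- A polynomial as a vector of length one. -/
noncomputable def toVec (σ k : Type*) [Field k] :
    MvPolynomial σ k ≃ₗ[MvPolynomial σ k] (Fin 1 → MvPolynomial σ k) :=
  (LinearEquiv.funUnique (Fin 1) (MvPolynomial σ k) (MvPolynomial σ k)).symm

@[simp] theorem toVec_apply (p : MvPolynomial σ k) (b : Fin 1) : toVec σ k p b = p := rfl

theorem isHomogeneousVector_toVec {m : σ →₀ ℕ} {p : MvPolynomial σ k} :
    IsHomogeneousVector (fun _ => 0) m (toVec σ k p) ↔ ∀ s ∈ p.support, s = m := by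
  simp [IsHomogeneousVector]

end Homogeneous

/-! ### From multigraded resolutions to filtered ones. -/

namespace MinimalMultigradedFreeResolution

variable {σ k : Type*} [Field k] {I : Ideal (MvPolynomial σ k)}

theorem isHomogeneousMap_toVec_aug (F : MinimalMultigradedFreeResolution I) :
    IsHomogeneousMap (F.deg 0) (fun _ : Fin 1 => 0) ((toVec σ k).toLinearMap.comp F.aug) :=
  fun m v hv => isHomogeneousVector_toVec.2 (F.aug_homogeneous m v hv)

/-- The dehomogenization of a multigraded free resolution. -/
noncomputable def toStrandResolution (F : MinimalMultigradedFreeResolution I) :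
    StrandResolution k (fun m => monomial m (1 : k) ∈ I) where
  ι i := Fin (F.rank i)
  fin _ := inferInstance
  deg := F.deg
  D i := dehomogenizeMap (F.d i)
  aug := (dehomogenizeMap ((toVec σ k).toLinearMap.comp F.aug)).submatrix (fun _ => 0) id
  D_filtered i := IsHomogeneousMap.isFiltered (F.d_homogeneous i)
  aug_filtered b hb := by
    -- The image of a basis vector is c x^deg and lies in `I`; when c ≠ 0 it can be divided out.
    have h := (F.isHomogeneousMap_toVec_aug _ _ (isHomogeneousVector_basis (F.deg 0) b)).eq_monomial 0
    have hc : eval 1 (F.aug (Pi.single b 1)) ≠ 0 := hb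
    have hI : F.aug (Pi.single b 1) ∈ I := F.range_aug.le (LinearMap.mem_range_self _ _)
    simp only [LinearMap.comp_apply, LinearEquiv.coe_coe, toVec_apply, tsub_zero] at h
    set c := coeff (F.deg 0 b) (F.aug (Pi.single b 1))
    rw [h, eval_one_monomial] at hc
    rw [h] at hI
    have := I.mul_mem_left (C c⁻¹) hI
    rwa [C_mul_monomial, inv_mul_cancel₀ hc] at this
  aug_surjective m hm := by
    obtain ⟨w, hw, hw'⟩ := F.isHomogeneousMap_toVec_aug.exists_preimage (m := m) (v := 1)
      (fun _ _ => zero_le) (by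
        rw [← F.range_aug] at hm
        obtain ⟨u, hu⟩ := hm
        refine ⟨u, ?_⟩
        ext1 b
        simp [hu, homogenize])
    exact ⟨w, hw, funext fun _ => congrFun hw' 0⟩
  aug_mul_D := by
    have : Function.Exact (F.d 0) ((toVec σ k).toLinearMap.comp F.aug) := fun v => by
      simpa using F.exact_zero v
    ext x b
    exact congrFun (congrFun (exact_mul_eq_zero this) 0) b
  D_mul_D i := exact_mul_eq_zero (F.exact_succ i)
  exact_zero m v hv h := by
    have hex : Function.Exact (F.d 0) ((toVec σ k).toLinearMap.comp F.aug) := fun v => by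
      simpa using F.exact_zero v
    refine IsHomogeneousMap.exists_of_exact (F.d_homogeneous 0) F.isHomogeneousMap_toVec_aug hex hv ?_
    ext x
    rw [Subsingleton.elim x 0]
    exact congrFun h ()
  exact_succ i m v hv h :=
    IsHomogeneousMap.exists_of_exact (F.d_homogeneous (i + 1)) (F.d_homogeneous i)
      (F.exact_succ i) hv h

/-- An entry between basis elements of equal degree is a constant, and minimality puts it in the
ideal of the variables. -/
theorem toStrandResolution_isMinimalAt (F : MinimalMultigradedFreeResolution I) (m : σ →₀ ℕ) :
    F.toStrandResolution.IsMinimalAt m := by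
  intro i b' b hb' hb
  have h := (F.d_homogeneous i _ _ (isHomogeneousVector_basis (F.deg (i + 1)) b)).eq_monomial b'
  have hmin := (mem_span_X_smul_top _).1 (F.minimal i ⟨Pi.single b 1, rfl⟩) b'
  have hdeg : F.deg (i + 1) b - F.deg i b' = 0 := by
    rw [show F.deg (i + 1) b = m from hb, show F.deg i b' = m from hb', tsub_self]
  rw [hdeg, hmin, monomial_zero] at h
  change eval 1 (F.d i (Pi.single b 1) b') = 0
  rw [h, map_zero]

end MinimalMultigradedFreeResolution

/-! ### The simplex on a finite ordered set and Taylor's resolution. -/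

section Taylor

variable {k G : Type*} [Field k] [LinearOrder G]

/-- The sign with which `W` occurs in the boundary of the simplex `insert w W`. -/
def faceSign (k : Type*) [Field k] {G : Type*} [LinearOrder G] (w : G) (W : Finset G) : k :=
  (-1) ^ (W.filter (· < w)).card

theorem faceSign_insert_of_lt {w x : G} {W : Finset G} (hx : x ∉ W) (h : x < w) :
    faceSign k w (insert x W) = -faceSign k w W := by
  rw [faceSign, faceSign, Finset.filter_insert, if_pos h, Finset.card_insert_of_notMem (by simp [hx]),
    pow_succ, mul_neg_one]

theorem faceSign_insert_of_not_lt {w x : G} {W : Finset G} (h : ¬ x < w) :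
    faceSign k w (insert x W) = faceSign k w W := by
  rw [faceSign, faceSign, Finset.filter_insert, if_neg h]

theorem faceSign_of_forall_le {w : G} {W : Finset G} (h : ∀ x ∈ W, w ≤ x) :
    faceSign k w W = 1 := by
  rw [faceSign, Finset.filter_false_of_mem fun x hx => not_lt.2 (h x hx), Finset.card_empty,
    pow_zero]

/-- Inserting the smaller vertex first flips the sign of the larger one, while inserting the larger
first changes nothing, so the two orders contribute opposite signs. -/
theorem faceSign_mul_faceSign {w x : G} {W : Finset G} (hw : w ∉ W) (hx : x ∉ W) (hwx : w ≠ x) :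
    faceSign k w W * faceSign k x (insert w W) + faceSign k x W * faceSign k w (insert x W) = 0 := by
  rcases lt_or_gt_of_ne hwx with h | h
  · rw [faceSign_insert_of_lt hw h, faceSign_insert_of_not_lt h.not_gt]; ring
  · rw [faceSign_insert_of_lt hx h, faceSign_insert_of_not_lt h.not_gt]; ring

variable [Fintype G]

/-- The boundary of a chain of the full simplex on `G`. -/
def simplexBoundary (v : Finset G → k) (W : Finset G) : k :=
  ∑ w : G, if w ∈ W then 0 else faceSign k w W * v (insert w W)

theorem simplexBoundary_simplexBoundary (v : Finset G → k) (W : Finset G) :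
    simplexBoundary (simplexBoundary v) W = 0 := by
  let f : G × G → k := fun p => if p.1 ∈ W ∨ p.2 ∈ insert p.1 W then 0 else
    faceSign k p.1 W * faceSign k p.2 (insert p.1 W) * v (insert p.2 (insert p.1 W))
  have hf : simplexBoundary (simplexBoundary v) W = ∑ p : G × G, f p := by
    rw [Fintype.sum_prod_type]
    refine Finset.sum_congr rfl fun w _ => ?_
    by_cases hw : w ∈ W
    · simp [f, hw]
    · rw [if_neg hw, simplexBoundary, Finset.mul_sum]
      refine Finset.sum_congr rfl fun x _ => ?_
      simp only [f, hw, false_or]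
      split_ifs
      · rw [mul_zero]
      · rw [mul_assoc]
  rw [hf]
  -- Adding w then x cancels against adding x then w; `f` is 0 on degenerate pairs, in particular on
  -- the diagonal.
  refine Finset.sum_involution (fun p _ => p.swap) ?_ ?_ (fun _ _ => Finset.mem_univ _)
    (fun p _ => Prod.swap_swap p)
  · rintro ⟨w, x⟩ -
    by_cases hw : w ∈ W
    · simp [f, hw]
    by_cases hx : x ∈ W
    · simp [f, hx]
    by_cases hwx : w = x
    · simp [f, hwx]
    · simp only [f, Prod.swap, hw, hx, hwx, Ne.symm hwx, Finset.mem_insert, or_self, if_false]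
      rw [Finset.insert_comm w x, ← add_mul, faceSign_mul_faceSign hw hx hwx, zero_mul]
  · rintro ⟨w, x⟩ - h heq
    obtain rfl : x = w := congrArg Prod.fst heq
    simp [f] at h

/-- The cone with apex `g`. -/
def simplexCone (g : G) (v : Finset G → k) (W : Finset G) : k :=
  if g ∈ W then v (W.erase g) else 0

/-- A cycle supported on simplices without vertices below `g` is the boundary of its cone. -/
theorem simplexBoundary_simplexCone (g : G) (v : Finset G → k)
    (hv : ∀ W, v W ≠ 0 → ∀ w ∈ W, g ≤ w)
    (hc : ∀ W, g ∉ W → simplexBoundary v W = 0) (W : Finset G) :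
    simplexBoundary (simplexCone g v) W = v W := by
  by_cases hg : g ∈ W
  · have h0 := hc (W.erase g) (Finset.notMem_erase g W)
    rw [simplexBoundary, ← Finset.add_sum_erase _ _ (Finset.mem_univ g),
      if_neg (Finset.notMem_erase g W), Finset.insert_erase hg] at h0
    have h1 : faceSign k g (W.erase g) * v W = v W := by
      by_cases h : v W = 0
      · rw [h, mul_zero]
      · rw [faceSign_of_forall_le fun x hx => hv W h x (Finset.mem_of_mem_erase hx), one_mul]
    rw [h1] at h0
    rw [eq_neg_of_add_eq_zero_left h0, simplexBoundary,
      ← Finset.add_sum_erase _ _ (Finset.mem_univ g), if_pos hg, zero_add, ← Finset.sum_neg_distrib]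
    refine Finset.sum_congr rfl fun w hw => ?_
    have hwg := Finset.ne_of_mem_erase hw
    by_cases hwW : w ∈ W
    · rw [if_pos hwW, if_pos (Finset.mem_erase.2 ⟨hwg, hwW⟩), neg_zero]
    rw [if_neg hwW, if_neg (fun h => hwW (Finset.mem_of_mem_erase h)), simplexCone,
      if_pos (Finset.mem_insert_of_mem hg), Finset.erase_insert_of_ne hwg]
    by_cases h : v (insert w (W.erase g)) = 0
    · rw [h, mul_zero, mul_zero, neg_zero]
    · have hlt : g < w := lt_of_le_of_ne (hv _ h w (Finset.mem_insert_self _ _)) hwg.symm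
      have hs := faceSign_insert_of_lt (k := k) (Finset.notMem_erase g W) hlt
      rw [Finset.insert_erase hg] at hs
      rw [hs, neg_mul]
  · rw [simplexBoundary, Finset.sum_eq_single g]
    · rw [if_neg hg, simplexCone, if_pos (Finset.mem_insert_self g W), Finset.erase_insert hg]
      by_cases h : v W = 0
      · rw [h, mul_zero]
      · rw [faceSign_of_forall_le (hv W h), one_mul]
    · intro w _ hw
      split_ifs
      · rfl
      · rw [simplexCone, if_neg (by simp [hg, hw.symm]), mul_zero]
    · simp

/-- The `i`-dimensional simplices on the vertex set `G`. -/
abbrev Simplex (G : Type*) (i : ℕ) : Type _ := {W : Finset G // W.card = i + 1}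

/-- Extension by zero of an `i`-chain. -/
def extendChain {k G : Type*} [Field k] {i : ℕ} (v : Simplex G i → k) (W : Finset G) : k :=
  if h : W.card = i + 1 then v ⟨W, h⟩ else 0

theorem extendChain_coe {k G : Type*} [Field k] {i : ℕ} (v : Simplex G i → k) (W : Simplex G i) :
    extendChain v W.1 = v W := dif_pos W.2

/-- The matrix of the boundary of `(i + 1)`-chains. -/
def simplexMatrix (k G : Type*) [Field k] [LinearOrder G] (i : ℕ) :
    Matrix (Simplex G i) (Simplex G (i + 1)) k :=
  Matrix.of fun W V => ∑ w ∈ V.1, if V.1.erase w = W.1 then faceSign k w W.1 else 0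

theorem simplexMatrix_mulVec {i : ℕ} (v : Simplex G (i + 1) → k) (W : Simplex G i) :
    (simplexMatrix k G i).mulVec v W = simplexBoundary (extendChain v) W.1 := by
  have h : ∀ V : Simplex G (i + 1), simplexMatrix k G i W V * v V =
      ∑ w : G, if w ∉ W.1 ∧ insert w W.1 = V.1 then faceSign k w W.1 * v V else 0 := by
    intro V
    rw [simplexMatrix, Matrix.of_apply, Finset.sum_mul, ← Finset.sum_subset (Finset.subset_univ V.1)]
    · refine Finset.sum_congr rfl fun w hw => ?_
      have : V.1.erase w = W.1 ↔ w ∉ W.1 ∧ insert w W.1 = V.1 := by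
        constructor
        · intro h
          rw [← h]
          exact ⟨Finset.notMem_erase _ _, Finset.insert_erase hw⟩
        · rintro ⟨h, h'⟩
          rw [← h', Finset.erase_insert h]
      simp only [this, ite_mul, zero_mul]
    · intro w _ hw
      rw [if_neg]
      rintro ⟨-, h⟩
      exact hw (h ▸ Finset.mem_insert_self _ _)
  rw [Matrix.mulVec, dotProduct, Finset.sum_congr rfl fun V _ => h V, Finset.sum_comm]
  refine Finset.sum_congr rfl fun w _ => ?_
  by_cases hw : w ∈ W.1
  · simp [hw]
  · have hc : (insert w W.1).card = i + 1 + 1 := by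
      rw [Finset.card_insert_of_notMem hw, W.2]
    rw [if_neg hw, Finset.sum_eq_single ⟨insert w W.1, hc⟩]
    · rw [if_pos ⟨hw, rfl⟩, extendChain, dif_pos hc]
    · intro V _ hV
      rw [if_neg]
      rintro ⟨-, h⟩
      exact hV (Subtype.ext h.symm)
    · simp

theorem simplexBoundary_extendChain_of_card_ne {i : ℕ} (v : Simplex G (i + 1) → k) (W : Finset G)
    (h : W.card ≠ i + 1) : simplexBoundary (extendChain v) W = 0 := by
  refine Finset.sum_eq_zero fun w _ => ?_
  split_ifs with hw
  · rfl
  · rw [extendChain, dif_neg, mul_zero]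
    rw [Finset.card_insert_of_notMem hw]
    omega

theorem extendChain_simplexMatrix_mulVec {i : ℕ} (v : Simplex G (i + 1) → k) :
    extendChain ((simplexMatrix k G i).mulVec v) = simplexBoundary (extendChain v) := by
  ext W
  by_cases h : W.card = i + 1
  · rw [extendChain, dif_pos h, simplexMatrix_mulVec]
  · rw [extendChain, dif_neg h, simplexBoundary_extendChain_of_card_ne v W h]

theorem simplexMatrix_mul_simplexMatrix (i : ℕ) :
    simplexMatrix k G i * simplexMatrix k G (i + 1) = 0 := by
  refine Matrix.ext_of_mulVec_single fun V => ?_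
  ext W
  rw [← Matrix.mulVec_mulVec, simplexMatrix_mulVec, extendChain_simplexMatrix_mulVec,
    simplexBoundary_simplexBoundary, Matrix.zero_mulVec, Pi.zero_apply]

/-- The vertices of degree at most m span a full simplex, which is a cone. The cycle condition is
imposed on all W, the empty one included, so that i = 0 is covered as well. -/
theorem exists_simplexMatrix_mulVec_eq {P : Type*} [SemilatticeSup P] [OrderBot P] (e : G → P)
    {i : ℕ} {m : P} {v : Simplex G i → k} (hv : IsBelow (fun W : Simplex G i => W.1.sup e) m v)
    (hc : ∀ W, simplexBoundary (extendChain v) W = 0) :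
    ∃ w, IsBelow (fun W : Simplex G (i + 1) => W.1.sup e) m w ∧
      (simplexMatrix k G i).mulVec w = v := by
  classical
  have hv' : ∀ W, extendChain v W ≠ 0 → ∀ x ∈ W, e x ≤ m := by
    intro W hW x hx
    rw [extendChain] at hW
    split_ifs at hW with h
    · exact (Finset.le_sup hx).trans (hv _ hW)
    · exact absurd rfl hW
  by_cases hne : ∃ x, e x ≤ m
  -- The apex is the first vertex of degree at most m: coning then keeps degrees below m and
  -- introduces no sign.
  · obtain ⟨g, hg, hmin⟩ := Finset.exists_minimal (s := Finset.univ.filter fun x => e x ≤ m)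
      (by obtain ⟨x, hx⟩ := hne; exact ⟨x, by simpa using hx⟩)
    have hg' : e g ≤ m := by simpa using hg
    have hle : ∀ x, e x ≤ m → g ≤ x := fun x hx => by
      rcases le_total g x with h | h
      · exact h
      · exact hmin (by simpa using hx) h
    refine ⟨fun W => simplexCone g (extendChain v) W.1, fun W hW => ?_, ?_⟩
    · refine Finset.sup_le fun x hx => ?_
      change simplexCone g (extendChain v) W.1 ≠ 0 at hW
      rw [simplexCone] at hW
      split_ifs at hW with h
      · by_cases hxg : x = g
        · rwa [hxg]
        · exact hv' _ hW x (Finset.mem_erase.2 ⟨hxg, hx⟩)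
      · exact absurd rfl hW
    · have he : extendChain (fun W : Simplex G (i + 1) => simplexCone g (extendChain v) W.1) =
          simplexCone g (extendChain v) := by
        ext W
        by_cases hW : W.card = i + 1 + 1
        · rw [extendChain, dif_pos hW]
        · rw [extendChain, dif_neg hW]
          by_cases h : g ∈ W
          · rw [simplexCone, if_pos h]
            rw [extendChain, dif_neg]
            rw [Finset.card_erase_of_mem h]
            have := Finset.card_pos.2 ⟨g, h⟩
            omega
          · rw [simplexCone, if_neg h]
      ext W
      rw [simplexMatrix_mulVec, he, simplexBoundary_simplexCone g _
        (fun V hV x hx => hle x (hv' V hV x hx)) (fun V _ => hc V), extendChain_coe]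
  -- Without a vertex below m the chain `v` itself is 0.
  · refine ⟨0, fun W hW => absurd rfl hW, ?_⟩
    ext W
    rw [Matrix.mulVec_zero, Pi.zero_apply]
    by_contra h
    obtain ⟨x, hx⟩ : W.1.Nonempty := Finset.card_pos.1 (by rw [W.2]; exact Nat.succ_pos i)
    exact hne ⟨x, hv' W.1 (by rw [extendChain_coe]; exact Ne.symm h) x hx⟩

/-- Identifies the augmentation with the boundary onto the empty simplex, so the start of the
complex needs no separate argument. -/
theorem sum_eq_simplexBoundary_empty (v : Simplex G 0 → k) :
    ∑ W, v W = simplexBoundary (extendChain v) ∅ := by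
  symm
  refine Finset.sum_bij (fun w _ => ⟨{w}, Finset.card_singleton w⟩) (fun _ _ => Finset.mem_univ _)
    (fun _ _ _ _ h => Finset.singleton_injective (congrArg Subtype.val h)) (fun W _ => ?_)
    (fun w _ => ?_)
  · obtain ⟨w, hw⟩ := Finset.card_eq_one.1 W.2
    exact ⟨w, Finset.mem_univ _, Subtype.ext hw.symm⟩
  · rw [if_neg (Finset.notMem_empty w), faceSign_of_forall_le (by simp), one_mul, insert_empty_eq]
    exact extendChain_coe v ⟨{w}, Finset.card_singleton w⟩

/-- The dehomogenized Taylor resolution of the monomials of degrees `e g`. -/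
noncomputable def taylorResolution (k : Type*) [Field k] {G P : Type} [LinearOrder G] [Fintype G]
    [SemilatticeSup P] [OrderBot P] (e : G → P) :
    StrandResolution k (fun m => ∃ g, e g ≤ m) where
  ι := Simplex G
  fin _ := inferInstance
  deg _ W := W.1.sup e
  D := simplexMatrix k G
  aug := Matrix.of fun _ _ => 1
  D_filtered i W V h := by
    obtain ⟨w, -, hw⟩ := Finset.exists_ne_zero_of_sum_ne_zero h
    split_ifs at hw with h'
    · change W.1.sup e ≤ V.1.sup e
      rw [← h']
      exact Finset.sup_mono (Finset.erase_subset _ _)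
    · exact absurd rfl hw
  aug_filtered W _ := by
    obtain ⟨x, hx⟩ : W.1.Nonempty := Finset.card_pos.1 (by rw [W.2]; exact Nat.one_pos)
    exact ⟨x, Finset.le_sup hx⟩
  aug_surjective m hm := by
    obtain ⟨g, hg⟩ := hm
    refine ⟨Pi.single ⟨{g}, Finset.card_singleton g⟩ 1, fun W hW => ?_, ?_⟩
    · have : W = ⟨{g}, Finset.card_singleton g⟩ := by
        by_contra h
        exact hW (Pi.single_eq_of_ne h _)
      rw [this]
      simpa using hg
    · ext
      simp
  aug_mul_D := by
    refine Matrix.ext_of_mulVec_single fun V => ?_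
    ext
    rw [← Matrix.mulVec_mulVec, Matrix.zero_mulVec, Pi.zero_apply, Matrix.mulVec, dotProduct]
    simp only [Matrix.of_apply, one_mul]
    rw [sum_eq_simplexBoundary_empty, extendChain_simplexMatrix_mulVec,
      simplexBoundary_simplexBoundary]
  D_mul_D := simplexMatrix_mul_simplexMatrix
  exact_zero m v hv h := by
    refine exists_simplexMatrix_mulVec_eq e hv fun W => ?_
    by_cases hW : W = ∅
    · rw [hW, ← sum_eq_simplexBoundary_empty]
      simpa [Matrix.mulVec, dotProduct] using congrFun h ()
    · refine Finset.sum_eq_zero fun w _ => ?_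
      split_ifs with hw
      · rfl
      · rw [extendChain, dif_neg, mul_zero]
        rw [Finset.card_insert_of_notMem hw]
        have := Finset.card_pos.2 (Finset.nonempty_iff_ne_empty.2 hW)
        omega
  exact_succ i m v hv h := by
    refine exists_simplexMatrix_mulVec_eq e hv fun W => ?_
    rw [← extendChain_simplexMatrix_mulVec, h]
    simp [extendChain]

end Taylor

/-! ### Existence of minimal multigraded free resolutions. -/

section Existence

variable {σ k : Type*} [Field k]

/-- A submodule of a graded free module that contains the homogeneous parts of its elements. -/
def IsHomogeneousSubmodule {n : ℕ} (deg : Fin n → σ →₀ ℕ)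
    (M : Submodule (MvPolynomial σ k) (Fin n → MvPolynomial σ k)) : Prop :=
  ∀ m, ∀ v ∈ M, homogeneousPart deg m v ∈ M

theorem IsHomogeneousMap.isHomogeneousSubmodule_ker {n n' : ℕ} {deg : Fin n → σ →₀ ℕ}
    {deg' : Fin n' → σ →₀ ℕ}
    {d : (Fin n → MvPolynomial σ k) →ₗ[MvPolynomial σ k] (Fin n' → MvPolynomial σ k)}
    (hd : IsHomogeneousMap deg deg' d) : IsHomogeneousSubmodule deg (LinearMap.ker d) := by
  intro m v hv
  rw [LinearMap.mem_ker] at hv ⊢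
  rw [hd.map_homogeneousPart, hv, map_zero]

/-- A vector is a combination of its homogeneous parts. -/
theorem mem_span_homogeneousPart {n : ℕ} (deg : Fin n → σ →₀ ℕ)
    (v : Fin n → MvPolynomial σ k) :
    v ∈ Submodule.span k (Set.range fun m => homogeneousPart deg m v) := by
  classical
  -- The finitely many degrees in which `v` has a nonzero part.
  let s : Finset (σ →₀ ℕ) := Finset.univ.biUnion fun b => (v b).support.image (· + deg b)
  have : v = ∑ m ∈ s, homogeneousPart deg m v := by
    ext b t
    rw [Finset.sum_apply, coeff_sum, Finset.sum_eq_single (t + deg b)]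
    · rw [homogeneousPart_apply, if_pos le_add_self, add_tsub_cancel_right, coeff_monomial,
        if_pos rfl]
    · intro m _ hm
      rw [homogeneousPart_apply]
      split_ifs with h
      · rw [coeff_monomial, if_neg]
        rintro rfl
        exact hm (tsub_add_cancel_of_le h).symm
      · exact coeff_zero t
    · intro h
      rw [homogeneousPart_apply, if_pos le_add_self, add_tsub_cancel_right, coeff_monomial,
        if_pos rfl]
      by_contra h0
      exact h (Finset.mem_biUnion.2 ⟨b, Finset.mem_univ b,
        Finset.mem_image_of_mem _ (mem_support_iff.2 h0)⟩)
  have hs : ∑ m ∈ s, homogeneousPart deg m v ∈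
      Submodule.span k (Set.range fun m => homogeneousPart deg m v) :=
    Submodule.sum_mem _ fun m _ => Submodule.subset_span (Set.mem_range_self m)
  rwa [← this] at hs

theorem exists_finset_homogeneous_span [Finite σ] {n : ℕ} {deg : Fin n → σ →₀ ℕ}
    {M : Submodule (MvPolynomial σ k) (Fin n → MvPolynomial σ k)}
    (hM : IsHomogeneousSubmodule deg M) :
    ∃ T : Finset (Fin n → MvPolynomial σ k), (∀ v ∈ T, ∃ m, IsHomogeneousVector deg m v) ∧
      Submodule.span (MvPolynomial σ k) (T : Set (Fin n → MvPolynomial σ k)) = M := by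
  have hfg : M.FG := IsNoetherian.noetherian M
  have hspan : M = Submodule.span (MvPolynomial σ k)
      {v | v ∈ M ∧ ∃ m, IsHomogeneousVector deg m v} := by
    refine le_antisymm (fun v hv => ?_) (Submodule.span_le.2 fun v hv => hv.1)
    refine Submodule.span_le_restrictScalars k (MvPolynomial σ k) _
      (Submodule.span_mono ?_ (mem_span_homogeneousPart deg v))
    refine Set.range_subset_iff.2 fun m => ?_
    exact ⟨hM m v hv, m, isHomogeneousVector_homogeneousPart deg m v⟩
  rw [hspan] at hfg
  obtain ⟨T, hT, hT'⟩ := (Submodule.fg_span_iff_fg_span_finset_subset _).1 hfg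
  exact ⟨T, fun v hv => (hT hv).2, hT'.symm.trans hspan.symm⟩

/-- A homogeneous submodule of a graded free module is the image of a graded free module under a map
with kernel inside `(x_s : s ∈ σ)` times the free module. -/
theorem exists_minimal_cover [Finite σ] {n : ℕ} {deg : Fin n → σ →₀ ℕ}
    {M : Submodule (MvPolynomial σ k) (Fin n → MvPolynomial σ k)}
    (hM : IsHomogeneousSubmodule deg M) :
    ∃ (N : ℕ) (deg' : Fin N → σ →₀ ℕ)
      (p : (Fin N → MvPolynomial σ k) →ₗ[MvPolynomial σ k] (Fin n → MvPolynomial σ k)),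
      IsHomogeneousMap deg' deg p ∧ LinearMap.range p = M ∧
      LinearMap.ker p ≤ Ideal.span (Set.range (X : σ → MvPolynomial σ k)) • ⊤ := by
  classical
  -- A homogeneous generating set of least cardinality: a syzygy with a nonzero constant term would
  -- make one generator redundant.
  obtain ⟨T, ⟨hT, hTM⟩, hmin⟩ := WellFounded.has_min (InvImage.wf Finset.card Nat.lt_wfRel.wf)
    _ (exists_finset_homogeneous_span hM)
  choose dg hdg using hT
  let E := T.equivFin.symm
  let p : (Fin T.card → MvPolynomial σ k) →ₗ[MvPolynomial σ k] (Fin n → MvPolynomial σ k) :=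
    Fintype.linearCombination (MvPolynomial σ k) fun j => (E j).1
  have hp : ∀ v, p v = ∑ j, v j • (E j).1 := fun v => Fintype.linearCombination_apply _ _ v
  have hhom : IsHomogeneousMap (fun j => dg (E j).1 (E j).2) deg p := by
    intro m v hv b s hs
    rw [hp, Finset.sum_apply] at hs
    obtain ⟨j, -, hj⟩ := Finset.mem_biUnion.1 (support_sum hs)
    obtain ⟨t, ht, u, hu, rfl⟩ := Finset.mem_add.1 (support_mul _ _ hj)
    rw [add_assoc, hdg _ (E j).2 b u hu, hv j t ht]
  refine ⟨T.card, fun j => dg (E j).1 (E j).2, p, hhom, ?_, fun v hv => ?_⟩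
  · rw [Fintype.range_linearCombination, ← hTM]
    congr 1
    ext v
    constructor
    · rintro ⟨j, rfl⟩
      exact (E j).2
    · intro hv
      exact ⟨E.symm ⟨v, hv⟩, by simp⟩
  · rw [mem_span_X_smul_top]
    by_contra! hcon
    obtain ⟨j, hj⟩ := hcon
    -- Passing to the part of the syzygy in the degree of the j-th generator makes its j-th
    -- coefficient the nonzero scalar c, which can be inverted.
    set m := dg (E j).1 (E j).2 with hm
    have hw := hhom.isHomogeneousSubmodule_ker m v hv
    set w := homogeneousPart (fun j => dg (E j).1 (E j).2) m v with hwdef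
    set c := coeff 0 (v j)
    have hwj : w j = C c := by
      rw [hwdef, homogeneousPart_apply, if_pos le_rfl, ← hm, tsub_self]
      rfl
    rw [LinearMap.mem_ker, hp, ← Finset.add_sum_erase _ _ (Finset.mem_univ j), hwj] at hw
    have hmem : (E j).1 ∈ Submodule.span (MvPolynomial σ k)
        ((T.erase (E j).1 : Finset _) : Set (Fin n → MvPolynomial σ k)) := by
      have h1 : (C c : MvPolynomial σ k) • (E j).1 ∈ Submodule.span (MvPolynomial σ k)
          ((T.erase (E j).1 : Finset _) : Set (Fin n → MvPolynomial σ k)) := by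
        rw [eq_neg_of_add_eq_zero_left hw]
        refine Submodule.neg_mem _ (Submodule.sum_mem _ fun i hi => Submodule.smul_mem _ _ ?_)
        refine Submodule.subset_span (Finset.mem_coe.2 (Finset.mem_erase.2 ⟨fun h => ?_, (E i).2⟩))
        exact Finset.ne_of_mem_erase hi (E.injective (Subtype.ext h))
      have h2 := Submodule.smul_mem _ (C c⁻¹ : MvPolynomial σ k) h1
      rwa [smul_smul, ← C_mul, inv_mul_cancel₀ hj, C_1, one_smul] at h2
    refine hmin (T.erase (E j).1)
      ⟨fun v hv => ⟨_, hdg v (Finset.mem_of_mem_erase hv)⟩, ?_⟩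
      (Finset.card_erase_lt_of_mem (E j).2)
    rw [← hTM]
    refine le_antisymm (Submodule.span_mono (by simp)) (Submodule.span_le.2 fun v hv => ?_)
    by_cases h : v = (E j).1
    · rw [h]; exact hmem
    · exact Submodule.subset_span (Finset.mem_coe.2 (Finset.mem_erase.2 ⟨h, hv⟩))

/-- A homogeneous submodule of a graded free module of finite rank. -/
structure GradedSubmodule (σ k : Type*) [Field k] where
  /-- the rank of the free module -/
  rank : ℕ
  /-- the multidegrees of its basis -/
  deg : Fin rank → σ →₀ ℕ
  /-- the submodule -/
  carrier : Submodule (MvPolynomial σ k) (Fin rank → MvPolynomial σ k)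
  homogeneous : IsHomogeneousSubmodule deg carrier

namespace GradedSubmodule

variable [Finite σ]

/-- The rank of a minimal cover. -/
noncomputable def coverRank (M : GradedSubmodule σ k) : ℕ :=
  (exists_minimal_cover M.homogeneous).choose

/-- The multidegrees of a minimal cover. -/
noncomputable def coverDeg (M : GradedSubmodule σ k) : Fin M.coverRank → σ →₀ ℕ :=
  (exists_minimal_cover M.homogeneous).choose_spec.choose

/-- A minimal cover of a homogeneous submodule. -/
noncomputable def cover (M : GradedSubmodule σ k) :
    (Fin M.coverRank → MvPolynomial σ k) →ₗ[MvPolynomial σ k] (Fin M.rank → MvPolynomial σ k) :=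
  (exists_minimal_cover M.homogeneous).choose_spec.choose_spec.choose

theorem isHomogeneousMap_cover (M : GradedSubmodule σ k) :
    IsHomogeneousMap M.coverDeg M.deg M.cover :=
  (exists_minimal_cover M.homogeneous).choose_spec.choose_spec.choose_spec.1

theorem range_cover (M : GradedSubmodule σ k) : LinearMap.range M.cover = M.carrier :=
  (exists_minimal_cover M.homogeneous).choose_spec.choose_spec.choose_spec.2.1

theorem ker_cover_le (M : GradedSubmodule σ k) :
    LinearMap.ker M.cover ≤ Ideal.span (Set.range (X : σ → MvPolynomial σ k)) • ⊤ :=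
  (exists_minimal_cover M.homogeneous).choose_spec.choose_spec.choose_spec.2.2

/-- The kernel of the minimal cover. -/
noncomputable def syzygy (M : GradedSubmodule σ k) : GradedSubmodule σ k where
  rank := M.coverRank
  deg := M.coverDeg
  carrier := LinearMap.ker M.cover
  homogeneous := M.isHomogeneousMap_cover.isHomogeneousSubmodule_ker

/-- The iterated syzygies. -/
noncomputable def iterSyzygy (M : GradedSubmodule σ k) : ℕ → GradedSubmodule σ k
  | 0 => M.syzygy
  | i + 1 => (M.iterSyzygy i).syzygy

theorem exact_cover (M : GradedSubmodule σ k) : Function.Exact M.syzygy.cover M.cover :=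
  LinearMap.exact_iff.2 M.syzygy.range_cover.symm

end GradedSubmodule

/-- A monomial ideal as a graded submodule of the free module of rank one. -/
noncomputable def monomialGradedSubmodule (A : Set (σ →₀ ℕ)) : GradedSubmodule σ k where
  rank := 1
  deg _ := 0
  carrier := Submodule.map (toVec σ k).toLinearMap
    (Ideal.span ((fun s => monomial s (1 : k)) '' A))
  homogeneous := by
    classical
    rintro m _ ⟨p, hp, rfl⟩
    have hp' := mem_ideal_span_monomial_image.1 hp
    refine ⟨monomial m (coeff m p), mem_ideal_span_monomial_image.2 fun s hs => ?_, ?_⟩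
    · have hsm := Finset.mem_singleton.1 (support_monomial_subset hs)
      rw [mem_support_iff, hsm, coeff_monomial, if_pos rfl] at hs
      rw [hsm]
      exact hp' m (mem_support_iff.2 hs)
    · ext1 b
      rw [homogeneousPart_apply, if_pos (zero_le)]
      simp

/-- Monomial ideals have minimal multigraded free resolutions. -/
theorem nonempty_minimalMultigradedFreeResolution [Finite σ] (A : Set (σ →₀ ℕ)) :
    Nonempty (MinimalMultigradedFreeResolution
      (Ideal.span ((fun s => monomial s (1 : k)) '' A))) := by
  let M : GradedSubmodule σ k := monomialGradedSubmodule A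
  let p : (Fin M.coverRank → MvPolynomial σ k) →ₗ[MvPolynomial σ k] (Fin 1 → MvPolynomial σ k) :=
    M.cover
  refine ⟨{
    rank := fun i => (M.iterSyzygy i).rank
    deg := fun i => (M.iterSyzygy i).deg
    d := fun i => (M.iterSyzygy i).cover
    aug := (toVec σ k).symm.toLinearMap.comp p
    d_homogeneous := fun i => (M.iterSyzygy i).isHomogeneousMap_cover
    aug_homogeneous := fun m v hv => ?_
    range_aug := ?_
    exact_zero := fun v => ?_
    exact_succ := fun i => (M.iterSyzygy i).exact_cover
    minimal := fun i => ?_ }⟩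
  · intro s hs
    have h : s + 0 = m := M.isHomogeneousMap_cover m v hv (0 : Fin 1) s hs
    rwa [add_zero] at h
  · have hr : LinearMap.range p = Submodule.map (toVec σ k).toLinearMap
      (Ideal.span ((fun s => monomial s (1 : k)) '' A)) := M.range_cover
    ext f
    constructor
    · rintro ⟨u, rfl⟩
      obtain ⟨f, hf, he⟩ := hr.le (LinearMap.mem_range_self p u)
      change p u 0 ∈ _
      rw [← he]
      exact hf
    · intro hf
      obtain ⟨u, hu⟩ := hr.ge (Submodule.mem_map_of_mem hf)
      exact ⟨u, congrFun hu 0⟩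
  · refine Iff.trans ?_ (M.exact_cover v)
    exact (toVec σ k).symm.map_eq_zero_iff
  -- The image of each differential is the kernel of the preceding minimal cover.
  · refine (M.iterSyzygy i).range_cover.le.trans ?_
    cases i with
    | zero => exact M.ker_cover_le
    | succ i => exact (M.iterSyzygy i).ker_cover_le

end Existence

/-! ### Divisibility among the monomials ε^c. -/

section ExtremalPowers

theorem extremalExponent_apply {q : ℕ} (c : Fin q → ℕ) (A : ExtremalVar q) :
    extremalExponent c A = ∑ i ∈ A.1, c i := rfl

open scoped Pointwise in
/-- The powers of the extremal ideal are monomial ideals. -/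
theorem extremalIdeal_pow (k : Type*) [Field k] (q r : ℕ) :
    extremalIdeal k q ^ r = Ideal.span ((fun s => monomial s (1 : k)) ''
      (extremalExponent '' {c : Fin q → ℕ | ∑ i, c i = r})) := by
  refine le_antisymm ?_ (Ideal.span_le.2 ?_)
  · rw [extremalIdeal, Ideal.span, Submodule.span_pow]
    refine Submodule.span_mono fun p hp => ?_
    induction r generalizing p with
    | zero =>
      rw [pow_zero, Set.mem_one] at hp
      refine ⟨_, ⟨0, by simp, rfl⟩, ?_⟩
      dsimp only
      rw [← prod_extremalGen_pow, hp]
      simp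
    | succ r ih =>
      rw [pow_succ] at hp
      obtain ⟨p', hp', _, ⟨i, rfl⟩, rfl⟩ := Set.mem_mul.1 hp
      obtain ⟨_, ⟨c, hc, rfl⟩, rfl⟩ := ih _ hp'
      refine ⟨_, ⟨c + Pi.single i 1, ?_, rfl⟩, ?_⟩
      · simpa [Finset.sum_add_distrib] using hc
      · simp only [← prod_extremalGen_pow, Pi.add_apply, pow_add, Finset.prod_mul_distrib]
        congr 1
        rw [Finset.prod_eq_single i]
        · simp
        · intro j _ hj
          simp [hj]
        · simp
  · rintro _ ⟨_, ⟨c, hc, rfl⟩, rfl⟩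
    dsimp only
    rw [← prod_extremalGen_pow, ← show ∑ i, c i = r from hc, SetLike.mem_coe,
      ← Finset.prod_pow_eq_pow_sum]
    exact Ideal.prod_mem_prod fun i _ =>
      Ideal.pow_mem_pow (Ideal.subset_span (Set.mem_range_self i)) _

theorem monomial_mem_extremalIdeal_pow (k : Type*) [Field k] (q r : ℕ) (m : ExtremalVar q →₀ ℕ) :
    monomial m (1 : k) ∈ extremalIdeal k q ^ r ↔
      ∃ c : {c : Fin q → ℕ // ∑ i, c i = r}, extremalExponent c.1 ≤ m := by
  classical
  rw [extremalIdeal_pow, mem_ideal_span_monomial_image]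
  constructor
  · intro h
    obtain ⟨_, ⟨c, hc, rfl⟩, hle⟩ := h m (by rw [mem_support_iff, coeff_monomial, if_pos rfl]; exact one_ne_zero)
    exact ⟨⟨c, hc⟩, hle⟩
  · rintro ⟨c, hle⟩ s hs
    rw [Finset.mem_singleton.1 (support_monomial_subset hs)]
    exact ⟨_, ⟨c.1, c.2, rfl⟩, hle⟩

variable {q r : ℕ} {a : Fin q → ℕ}

theorem mem_shiftedSquarefreeFace {c : Fin q → ℕ} :
    c ∈ shiftedSquarefreeFace r a ↔ (∀ i, a i ≤ c i ∧ c i ≤ a i + 1) ∧ ∑ i, c i = r := by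
  simp [shiftedSquarefreeFace, Pi.le_def, forall_and]

/-- The vector `a + 1_B`. -/
def shiftBy (a : Fin q → ℕ) (B : Finset (Fin q)) (i : Fin q) : ℕ := a i + if i ∈ B then 1 else 0

theorem sum_shiftBy (a : Fin q → ℕ) (B A : Finset (Fin q)) :
    ∑ i ∈ A, shiftBy a B i = ∑ i ∈ A, a i + (A ∩ B).card := by
  simp [shiftBy, Finset.sum_add_distrib]

theorem shiftBy_injective (a : Fin q → ℕ) : Function.Injective (shiftBy a) := by
  intro B B' h
  ext i
  have := congrFun h i
  simp only [shiftBy] at this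
  by_cases h1 : i ∈ B <;> by_cases h2 : i ∈ B' <;> simp_all

/-- The face consists of the vectors `a + 1_B` with `|B| = r - |a|`. -/
theorem shiftedSquarefreeFace_eq (ha : ∑ i, a i ≤ r) :
    shiftedSquarefreeFace r a =
      (Finset.powersetCard (r - ∑ i, a i) Finset.univ).image (shiftBy a) := by
  ext c
  rw [mem_shiftedSquarefreeFace, Finset.mem_image]
  constructor
  · rintro ⟨h, hr⟩
    -- B is recovered as the set of indices where c exceeds a.
    have hc : shiftBy a {i | c i = a i + 1} = c := by
      ext i
      have := h i
      simp only [shiftBy, Finset.mem_filter, Finset.mem_univ, true_and]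
      split_ifs <;> omega
    refine ⟨_, ?_, hc⟩
    have := sum_shiftBy a {i | c i = a i + 1} Finset.univ
    rw [hc, hr, Finset.univ_inter] at this
    rw [Finset.mem_powersetCard]
    exact ⟨Finset.subset_univ _, by omega⟩
  · rintro ⟨B, hB, rfl⟩
    rw [Finset.mem_powersetCard] at hB
    refine ⟨fun i => ?_, ?_⟩
    · simp only [shiftBy]
      split_ifs <;> omega
    · rw [sum_shiftBy, Finset.univ_inter, hB.2]
      omega

theorem card_shiftedSquarefreeFace (ha : ∑ i, a i ≤ r) :
    (shiftedSquarefreeFace r a).card = q.choose (r - ∑ i, a i) := by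
  rw [shiftedSquarefreeFace_eq ha, Finset.card_image_of_injective _ (shiftBy_injective a),
    Finset.card_powersetCard, Finset.card_univ, Fintype.card_fin]

/-- The label is a supremum of finitely supported functions; changing its value at A to n still
gives an upper bound. -/
theorem monomialLabel_apply_le {s : Finset (Fin q → ℕ)} {A : ExtremalVar q} {n : ℕ}
    (h : ∀ c ∈ s, extremalExponent c A ≤ n) : monomialLabel s A ≤ n := by
  classical
  have : monomialLabel s ≤ Finsupp.update (monomialLabel s) A n := by
    refine Finset.sup_le fun c hc B => ?_
    rw [Finsupp.update_apply]
    split_ifs with hB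
    · rw [hB]; exact h c hc
    · exact (Finset.le_sup (f := extremalExponent) hc : extremalExponent c ≤ _) B
  simpa using this A

/-- At a + 1_B the exponent of x_A is the sum of a over A plus |A ∩ B|, with |B| = r - |a|. Only
this upper bound on the label is needed. -/
theorem monomialLabel_face_apply_le (ha : ∑ i, a i ≤ r) (A : ExtremalVar q) :
    monomialLabel (shiftedSquarefreeFace r a) A ≤
      ∑ i ∈ A.1, a i + min A.1.card (r - ∑ i, a i) := by
  refine monomialLabel_apply_le fun c hc => ?_
  rw [shiftedSquarefreeFace_eq ha, Finset.mem_image] at hc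
  obtain ⟨B, hB, rfl⟩ := hc
  rw [Finset.mem_powersetCard] at hB
  rw [extremalExponent_apply, sum_shiftBy]
  gcongr
  exact le_min (Finset.card_le_card Finset.inter_subset_left)
    ((Finset.card_le_card Finset.inter_subset_right).trans hB.2.le)

/-- A monomial `ε^c` with `|c| = r` that divides the label of the face belongs to it. -/
theorem mem_face_of_le_monomialLabel (ha : ∑ i, a i ≤ r) {c : Fin q → ℕ} (hc : ∑ i, c i = r)
    (hle : extremalExponent c ≤ monomialLabel (shiftedSquarefreeFace r a)) :
    c ∈ shiftedSquarefreeFace r a := by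
  have key : ∀ A : Finset (Fin q), A.Nonempty →
      ∑ i ∈ A, c i ≤ ∑ i ∈ A, a i + min A.card (r - ∑ i, a i) := fun A hA =>
    (hle ⟨A, hA⟩).trans (monomialLabel_face_apply_le ha ⟨A, hA⟩)
  refine mem_shiftedSquarefreeFace.2 ⟨fun i => ⟨?_, ?_⟩, hc⟩
  -- Lower bound on c_i: over the complement of i, c sums to at most the sum of a plus r - |a|,
  -- while |c| = r. For q = 1 the complement is empty and carries no variable, but then c_i = r.
  · have hs := Finset.add_sum_erase Finset.univ c (Finset.mem_univ i)
    have hsa := Finset.add_sum_erase Finset.univ a (Finset.mem_univ i)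
    rcases (Finset.univ.erase i).eq_empty_or_nonempty with h | h
    · rw [h, Finset.sum_empty] at hs hsa
      omega
    · have := key _ h
      have := min_le_right (Finset.univ.erase i).card (r - ∑ i, a i)
      omega
  · have := key {i} (Finset.singleton_nonempty i)
    simp only [Finset.sum_singleton, Finset.card_singleton] at this
    have := min_le_left 1 (r - ∑ i, a i)
    omega

/-- The face has no proper subset with the same label. -/
theorem eq_face_of_monomialLabel_eq (ha : ∑ i, a i < r) {s : Finset (Fin q → ℕ)}
    (hs : s ⊆ shiftedSquarefreeFace r a)
    (h : monomialLabel s = monomialLabel (shiftedSquarefreeFace r a)) :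
    s = shiftedSquarefreeFace r a := by
  refine hs.antisymm fun c hc => ?_
  by_contra hcs
  have hc' := hc
  rw [shiftedSquarefreeFace_eq ha.le, Finset.mem_image] at hc'
  obtain ⟨B, hB, rfl⟩ := hc'
  have hBc := (Finset.mem_powersetCard.1 hB).2
  -- |B| = r - |a| is positive because |a| < r; this makes x_B a variable and lets |B| - 1 below be
  -- a genuine decrease.
  have hBne : B.Nonempty := Finset.card_pos.1 (by omega)
  have h1 : extremalExponent (shiftBy a B) ⟨B, hBne⟩ ≤
      monomialLabel (shiftedSquarefreeFace r a) ⟨B, hBne⟩ :=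
    (Finset.le_sup (f := extremalExponent) hc : extremalExponent (shiftBy a B) ≤ _) _
  rw [extremalExponent_apply, sum_shiftBy, Finset.inter_self] at h1
  have h2 : monomialLabel s ⟨B, hBne⟩ ≤ ∑ i ∈ B, a i + (B.card - 1) := by
    refine monomialLabel_apply_le fun d hd => ?_
    have hd' := hs hd
    rw [shiftedSquarefreeFace_eq ha.le, Finset.mem_image] at hd'
    obtain ⟨B', hB', rfl⟩ := hd'
    have hBc' := (Finset.mem_powersetCard.1 hB').2
    rw [extremalExponent_apply, sum_shiftBy]
    -- Sets of equal size meet in all of B only if they coincide, and B is the one missing from s.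
    have hlt : (B ∩ B').card < B.card := by
      refine Finset.card_lt_card (Finset.ssubset_iff_subset_ne.2 ⟨Finset.inter_subset_left, fun he => ?_⟩)
      have hsub : B ⊆ B' := Finset.inter_eq_left.1 he
      have : B = B' := Finset.eq_of_subset_of_card_le hsub (by rw [hBc, hBc'])
      exact hcs (this ▸ hd)
    dsimp only
    omega
  rw [h] at h2
  dsimp only at h1
  have := Finset.card_pos.2 hBne
  omega

end ExtremalPowers

/-! ### The Betti number in the degree of the face. -/

theorem corollaryc (k : Type*) [Field k] (r q : ℕ) (hr : 1 ≤ r) (hq : 1 ≤ q) (a : Fin q → ℕ)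
    (ha : (r : ℤ) - (q : ℤ) < ((∑ i, a i : ℕ) : ℤ)) (ha' : ∑ i, a i < r) :
    HasMultigradedBetti (extremalIdeal k q ^ r) (q.choose (r - ∑ i, a i) - 1)
      (monomialLabel (shiftedSquarefreeFace r a)) 1 := by
  classical
  refine ⟨extremalIdeal_pow k q r ▸ nonempty_minimalMultigradedFreeResolution _, fun F => ?_⟩
  set m := monomialLabel (shiftedSquarefreeFace r a) with hm
  let G : Type := {c : Fin q → ℕ // ∑ i, c i = r}
  have : Finite G := by
    refine Set.Finite.subset (Set.finite_Iic fun _ : Fin q => r) fun c hc i => ?_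
    rw [← show ∑ i, c i = r from hc]
    exact Finset.single_le_sum (fun _ _ => Nat.zero_le _) (Finset.mem_univ i)
  let _ : Fintype G := Fintype.ofFinite G
  -- Any linear order would do; it only fixes the signs.
  let _ : LinearOrder G := LinearOrder.lift' (fun c => toLex c.1)
    (fun _ _ h => Subtype.ext (toLex.injective h))
  let e : G → ExtremalVar q →₀ ℕ := fun c => extremalExponent c.1
  let Q : (ExtremalVar q →₀ ℕ) → Prop := fun m => monomial m (1 : k) ∈ extremalIdeal k q ^ r
  have hQ : (fun m => ∃ c : G, e c ≤ m) = Q :=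
    funext fun m => propext (monomial_mem_extremalIdeal_pow k q r m).symm
  let emb : G ↪ (Fin q → ℕ) := Function.Embedding.subtype _
  have hlabel : ∀ W : Finset G, W.sup e = monomialLabel (W.map emb) := fun W =>
    (Finset.sup_map W emb extremalExponent).symm
  let W₀ : Finset G := (shiftedSquarefreeFace r a).subtype _
  have hW₀ : W₀.map emb = shiftedSquarefreeFace r a :=
    Finset.subtype_map_of_mem fun c hc => (mem_shiftedSquarefreeFace.1 hc).2
  have hsup : ∀ W : Finset G, W.sup e = m ↔ W = W₀ := by
    intro W
    rw [hlabel, hm]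
    constructor
    · intro h
      refine Finset.map_injective emb ?_
      rw [hW₀]
      refine eq_face_of_monomialLabel_eq ha' (fun c hc => ?_) h
      obtain ⟨x, hx, rfl⟩ := Finset.mem_map.1 hc
      refine mem_face_of_le_monomialLabel ha'.le x.2 ?_
      rw [← h]
      exact Finset.le_sup (f := extremalExponent) hc
    · rintro rfl
      rw [hW₀]
  -- The bound r - q < |a| gives r - |a| ≤ q, so the binomial coefficient is positive and
  -- subtracting 1 is not truncated.
  have hcard : W₀.card = q.choose (r - ∑ i, a i) - 1 + 1 := by
    rw [← Finset.card_map emb, hW₀, card_shiftedSquarefreeFace ha'.le,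
      Nat.sub_add_cancel (Nat.choose_pos (by omega))]
  -- Taylor's resolution describes the ideal by divisibility and `F` by membership; a variable
  -- predicate lets the two be identified by substitution.
  have hcmp : ∀ Q' (_ : Q' = Q) (T : StrandResolution k Q') (_ : T.IsMinimalAt m) (i : ℕ),
      F.numGenerators i m = Nat.card {b // T.deg i b = m} := by
    rintro _ rfl T hT i
    exact StrandResolution.card_eq_card F.toStrandResolution T m
      (F.toStrandResolution_isMinimalAt m) hT i
  rw [hcmp _ hQ (taylorResolution k e)]
  · refine Nat.card_eq_one_iff_exists.2 ⟨⟨⟨W₀, hcard⟩, (hsup W₀).2 rfl⟩, ?_⟩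
    rintro ⟨⟨W, hW⟩, hWm⟩
    exact Subtype.ext (Subtype.ext ((hsup W).1 hWm))
  -- Minimality at m: both simplices would equal `W₀`, yet they have different cardinalities.
  · intro i W V hW hV
    have h := W.2.symm.trans (congrArg Finset.card (((hsup W.1).1 hW).trans ((hsup V.1).1 hV).symm))
    have h' := V.2
    omega
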